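/- Conventions. An extriangulated category $(\mathcal T,\mathbb E,\mathfrak s)$ is understood in the sense of Nakaoka–Palu. If $\mathfrak s(\delta)=[X\xrightarrow{x}Y\xrightarrow{y}Z]$ for some $\delta\in\mathbb E(Z,X)$, then $X\xrightarrow{x}Y\xrightarrow{y}Z$ is called a conflation, $x$ an inflation and $y$ a deflation. A morphism is *compatible* if it is an isomorphism whenever it is both an inflation and a deflation. A sequence $X\xrightarrow{f}Y\xrightarrow{g}Z$ is *right exact* if there are a conflation $K\xrightarrow{h_2}Y\xrightarrow{g}Z$ and a compatible deflation $h_1\colon X\to K$ with $f=h_2h_1$; *left exact* sequences are defined dually. A four-term sequence $X\xrightarrow{f}Y\xrightarrow{g}Z\xrightarrow{h}W$ is *right exact* (resp. *left exact*) if there are conflations $X\xrightarrow{f}Y\xrightarrow{g_1}K$ and $K\xrightarrow{g_2}Z\xrightarrow{h}W$ with $g=g_2g_1$ and $g_1$ (resp. $g_2$) compatible. An additive functor $F$ that preserves compatible morphisms is *right exact* (resp. *left exact*) if it preserves right (resp. left) exact sequences $X\to Y\to Z$; it is *exact* if there is a natural transformation $\eta\colon\mathbb E(-,-)\to\mathbb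 E'(F-,F-)$ of bifunctors with values in abelian groups such that $\mathfrak s(\delta)=[X\xrightarrow{x}Y\xrightarrow{y}Z]$ implies $\mathfrak s'(\eta(\delta))=[FX\xrightarrow{Fx}FY\xrightarrow{Fy}FZ]$. A *recollement* $(\mathcal A,\mathcal B,\mathcal C)$ of extriangulated categories consists of exact functors $i_*\colon\mathcal A\to\mathcal B$, $j^*\colon\mathcal B\to\mathcal C$, right exact functors $i^*\colon\mathcal B\to\mathcal A$, $j_!\colon\mathcal C\to\mathcal B$ and left exact functors $i^!\colon\mathcal B\to\mathcal A$, $j_*\colon\mathcal C\to\mathcal B$ such that: (R1) $(i^*,i_*,i^!)$ and $(j_!,j^*,j_*)$ are adjoint triples; (R2) the essential image of $i_*$ is $\operatorname{Ker}j^*$; (R3) $i_*,j_!,j_*$ are fully faithful; (R4) for each $B\in\mathcal B$ there is a left exact four-term sequence $i_*i^!B\to B\to j_*j^*B\to i_*A$ with $A\in\mathcal A$, and (R5) for each $B\in\mathcal B$ there is a right exact four-term sequence $i_*A'\to j_!j^*B\to B\to i_*i^*B$ with $A'\in\mathcal A$, where the maps into and out of $B$ are the adjunction morphisms. An object $P$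 of $\mathcal T$ is *projective* if for each conflation $X\to Y\xrightarrow{y}Z$ every morphism $P\to Z$ factors through $y$; injective objects are dual. $\mathcal T$ has enough projectives if each object $M$ has a conflation $K\to P\to M$ with $P$ projective; enough injectives is dual. $\mathcal T$ satisfies (WIC) if, for composable $f,g$, $gf$ inflation implies $f$ inflation and $gf$ deflation implies $g$ deflation. The projective dimension of $M\in\mathcal T$ is the least $n\ge 0$ (or $\infty$ if there is none) for which there are conflations $K_{i+1}\to P_i\to K_i$ $(0\le i\le n)$ with all $P_i$ projective, $K_0\cong M$ and $K_{n+1}=0$. The global dimension $\operatorname{gl}\mathcal T\in\mathbb N\cup\{\infty\}$ is the supremum of the projective dimensions of all objects of $\mathcal T$. Statement. Let $(\mathcal A,\mathcal B,\mathcal C)$ be a recollement of extriangulated categories, each of which satisfies (WIC) and has enough projectives and enough injectives. If $i^*$ and $i^!$ are exact, then $$\operatorname{gl}\mathcal B=\max\{\operatorname{gl}\mathcal A,\operatorname{gl}\mathcal C\}.$$ -/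

import Mathlib

open CategoryTheory CategoryTheory.Limits Opposite

universe w w₁ w₂ w₃ v v₁ v₂ v₃ u u₁ u₂ u₃

namespace Extri

section Bifunctor

variable {C : Type u} [Category.{v} C]

/-- The group `𝔼(Z, X)` of `𝔼`-extensions of `Z` by `X`. -/
abbrev Ext (E : Cᵒᵖ ⥤ C ⥤ AddCommGrpCat.{w}) (Z X : C) : Type w :=
  (E.obj (op Z)).obj X

/-- `a_* : 𝔼(Z, X) → 𝔼(Z, X')` for `a : X ⟶ X'`. -/
abbrev push (E : Cᵒᵖ ⥤ C ⥤ AddCommGrpCat.{w}) {Z X X' : C} (a : X ⟶ X') (δ : Ext E Z X) :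
    Ext E Z X' :=
  ((E.obj (op Z)).map a).hom δ

/-- `c^* : 𝔼(Z', X) → 𝔼(Z, X)` for `c : Z ⟶ Z'`. -/
abbrev pull (E : Cᵒᵖ ⥤ C ⥤ AddCommGrpCat.{w}) {Z Z' X : C} (c : Z ⟶ Z') (δ : Ext E Z' X) :
    Ext E Z X :=
  ((E.map c.op).app X).hom δ

/-- The direct sum `δ ⊕ δ' ∈ 𝔼(Z ⊕ Z', X ⊕ X')`: the extension whose components in
`𝔼(Z, X) ⊕ 𝔼(Z, X') ⊕ 𝔼(Z', X) ⊕ 𝔼(Z', X')` are `(δ, 0, 0, δ')`. -/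
noncomputable def dsum [Preadditive C] [HasZeroObject C] [HasBinaryBiproducts C]
    (E : Cᵒᵖ ⥤ C ⥤ AddCommGrpCat.{w}) {Z X Z' X' : C} (δ : Ext E Z X) (δ' : Ext E Z' X') :
    Ext E (Z ⊞ Z') (X ⊞ X') :=
  pull E (biprod.fst : Z ⊞ Z' ⟶ Z) (push E (biprod.inl : X ⟶ X ⊞ X') δ) +
    pull E (biprod.snd : Z ⊞ Z' ⟶ Z') (push E (biprod.inr : X' ⟶ X ⊞ X') δ')

end Bifunctor

/-- An extriangulated structure `(𝔼, 𝔰)` (in the sense of Nakaoka and Palu) on an additive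
category `C`.  The correspondence `𝔰` is encoded by the relation `Real δ x y`, which says that
the sequence `X ⟶ Y ⟶ Z` given by `x`, `y` belongs to the class `𝔰(δ)`; the fields `real_exists`
and `real_iff` say that `{(x, y) | Real δ x y}` is exactly one equivalence class of sequences. -/
structure ExtriStructure (C : Type u) [Category.{v} C] [Preadditive C]
    [HasZeroObject C] [HasBinaryBiproducts C] where
  /-- the bifunctor `𝔼 : Cᵒᵖ × C ⥤ Ab` -/
  E : Cᵒᵖ ⥤ C ⥤ AddCommGrpCat.{w}
  additive_left : E.Additive
  additive_right : ∀ Z : Cᵒᵖ, (E.obj Z).Additive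
  /-- `Real δ x y` : the sequence `(x, y)` belongs to `𝔰(δ)` -/
  Real : ∀ {X Y Z : C}, Ext E Z X → (X ⟶ Y) → (Y ⟶ Z) → Prop
  /-- `𝔰(δ)` is non-empty -/
  real_exists : ∀ {X Z : C} (δ : Ext E Z X), ∃ (Y : C) (x : X ⟶ Y) (y : Y ⟶ Z), Real δ x y
  /-- `𝔰(δ)` is a single class for the equivalence of sequences -/
  real_iff : ∀ {X Y Y' Z : C} {δ : Ext E Z X} {x : X ⟶ Y} {y : Y ⟶ Z} (x' : X ⟶ Y') (y' : Y' ⟶ Z),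
    Real δ x y → (Real δ x' y' ↔ ∃ b : Y ≅ Y', x ≫ b.hom = x' ∧ b.hom ≫ y' = y)
  /-- `𝔰` is a realization: morphisms of extensions lift to morphisms of sequences -/
  real_map : ∀ {X Y Z X' Y' Z' : C} {δ : Ext E Z X} {δ' : Ext E Z' X'}
    {x : X ⟶ Y} {y : Y ⟶ Z} {x' : X' ⟶ Y'} {y' : Y' ⟶ Z'}, Real δ x y → Real δ' x' y' →
    ∀ (a : X ⟶ X') (c : Z ⟶ Z'), push E a δ = pull E c δ' →
      ∃ b : Y ⟶ Y', x ≫ b = a ≫ x' ∧ y ≫ c = b ≫ y'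
  /-- `𝔰(0)` is the class of the split sequence -/
  real_zero : ∀ X Z : C,
    Real (0 : Ext E Z X) (biprod.inl : X ⟶ X ⊞ Z) (biprod.snd : X ⊞ Z ⟶ Z)
  /-- `𝔰(δ ⊕ δ') = 𝔰(δ) ⊕ 𝔰(δ')` -/
  real_dsum : ∀ {X Y Z X' Y' Z' : C} {δ : Ext E Z X} {δ' : Ext E Z' X'}
    {x : X ⟶ Y} {y : Y ⟶ Z} {x' : X' ⟶ Y'} {y' : Y' ⟶ Z'}, Real δ x y → Real δ' x' y' →
    Real (dsum E δ δ') (biprod.map x x') (biprod.map y y')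
  /-- (ET3) -/
  et3 : ∀ {X Y Z X' Y' Z' : C} {δ : Ext E Z X} {δ' : Ext E Z' X'}
    {x : X ⟶ Y} {y : Y ⟶ Z} {x' : X' ⟶ Y'} {y' : Y' ⟶ Z'}, Real δ x y → Real δ' x' y' →
    ∀ (a : X ⟶ X') (b : Y ⟶ Y'), x ≫ b = a ≫ x' →
      ∃ c : Z ⟶ Z', y ≫ c = b ≫ y' ∧ push E a δ = pull E c δ'
  /-- (ET3)ᵒᵖ -/
  et3_op : ∀ {X Y Z X' Y' Z' : C} {δ : Ext E Z X} {δ' : Ext E Z' X'}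
    {x : X ⟶ Y} {y : Y ⟶ Z} {x' : X' ⟶ Y'} {y' : Y' ⟶ Z'}, Real δ x y → Real δ' x' y' →
    ∀ (b : Y ⟶ Y') (c : Z ⟶ Z'), y ≫ c = b ≫ y' →
      ∃ a : X ⟶ X', x ≫ b = a ≫ x' ∧ push E a δ = pull E c δ'
  /-- (ET4) -/
  et4 : ∀ {A₀ B₀ C₀ D₀ F₀ : C} {δ : Ext E D₀ A₀} {δ' : Ext E F₀ B₀}
    {f : A₀ ⟶ B₀} {f' : B₀ ⟶ D₀} {g : B₀ ⟶ C₀} {g' : C₀ ⟶ F₀}, Real δ f f' → Real δ' g g' →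
    ∃ (E₀ : C) (h' : C₀ ⟶ E₀) (d : D₀ ⟶ E₀) (e : E₀ ⟶ F₀) (δ'' : Ext E E₀ A₀),
      f' ≫ d = g ≫ h' ∧ h' ≫ e = g' ∧ Real δ'' (f ≫ g) h' ∧
      Real (push E f' δ') d e ∧ pull E d δ'' = δ ∧ push E f δ'' = pull E e δ'
  /-- (ET4)ᵒᵖ -/
  et4_op : ∀ {A₀ B₀ C₀ D₀ F₀ : C} {δ : Ext E B₀ D₀} {δ' : Ext E C₀ F₀}
    {f' : D₀ ⟶ A₀} {f : A₀ ⟶ B₀} {g' : F₀ ⟶ B₀} {g : B₀ ⟶ C₀}, Real δ f' f → Real δ' g' g →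
    ∃ (E₀ : C) (d : D₀ ⟶ E₀) (e : E₀ ⟶ F₀) (h' : E₀ ⟶ A₀) (δ'' : Ext E C₀ E₀),
      d ≫ h' = f' ∧ h' ≫ f = e ≫ g' ∧ Real δ'' h' (f ≫ g) ∧
      Real (pull E g' δ) d e ∧ push E e δ'' = δ' ∧ push E d δ = pull E g δ''

namespace ExtriStructure

section Basic

variable {C : Type u} [Category.{v} C] [Preadditive C] [HasZeroObject C] [HasBinaryBiproducts C]
variable (S : ExtriStructure.{w} C)

/-- `X ⟶ Y ⟶ Z` is a conflation: it is part of an `𝔼`-triangle `X ⟶ Y ⟶ Z ⇢`. -/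
def IsConflation {X Y Z : C} (x : X ⟶ Y) (y : Y ⟶ Z) : Prop :=
  ∃ δ : Ext S.E Z X, S.Real δ x y

def IsInflation {X Y : C} (x : X ⟶ Y) : Prop :=
  ∃ (Z : C) (y : Y ⟶ Z), S.IsConflation x y

def IsDeflation {Y Z : C} (y : Y ⟶ Z) : Prop :=
  ∃ (X : C) (x : X ⟶ Y), S.IsConflation x y

/-- Condition (WIC). -/
structure WIC : Prop where
  inflation_of_comp : ∀ {X Y Z : C} (f : X ⟶ Y) (g : Y ⟶ Z),
    S.IsInflation (f ≫ g) → S.IsInflation f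
  deflation_of_comp : ∀ {X Y Z : C} (f : X ⟶ Y) (g : Y ⟶ Z),
    S.IsDeflation (f ≫ g) → S.IsDeflation g

/-- Projective objects of an extriangulated category (the subcategory `𝒫(C)`). -/
def projectives : ObjectProperty C := fun P =>
  ∀ {X Y Z : C} (x : X ⟶ Y) (y : Y ⟶ Z), S.IsConflation x y →
    ∀ c : P ⟶ Z, ∃ b : P ⟶ Y, b ≫ y = c

/-- Injective objects of an extriangulated category (the subcategory `ℐ(C)`). -/
def injectives : ObjectProperty C := fun I =>
  ∀ {X Y Z : C} (x : X ⟶ Y) (y : Y ⟶ Z), S.IsConflation x y →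
    ∀ a : X ⟶ I, ∃ b : Y ⟶ I, x ≫ b = a

def HasEnoughProjectives : Prop :=
  ∀ M : C, ∃ (K P : C) (k : K ⟶ P) (p : P ⟶ M), S.projectives P ∧ S.IsConflation k p

def HasEnoughInjectives : Prop :=
  ∀ M : C, ∃ (I L : C) (i : M ⟶ I) (l : I ⟶ L), S.injectives I ∧ S.IsConflation i l

/-- A morphism is compatible if, as soon as it is both an inflation and a deflation, it is an
isomorphism. -/
def IsCompatible {X Y : C} (f : X ⟶ Y) : Prop :=
  S.IsInflation f → S.IsDeflation f → IsIso f

/-- `X ⟶ Y ⟶ Z` is right exact: there are a conflation `K ⟶ Y ⟶ Z` and a compatible deflation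
`X ⟶ K` whose composite with `K ⟶ Y` is the given map. -/
def IsRightExactSeq {X Y Z : C} (f : X ⟶ Y) (g : Y ⟶ Z) : Prop :=
  ∃ (K : C) (h₁ : X ⟶ K) (h₂ : K ⟶ Y), S.IsConflation h₂ g ∧ S.IsDeflation h₁ ∧
    S.IsCompatible h₁ ∧ h₁ ≫ h₂ = f

/-- `X ⟶ Y ⟶ Z` is left exact: there are a conflation `X ⟶ Y ⟶ K` and a compatible inflation
`K ⟶ Z` whose composite with `Y ⟶ K` is the given map. -/
def IsLeftExactSeq {X Y Z : C} (f : X ⟶ Y) (g : Y ⟶ Z) : Prop :=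
  ∃ (K : C) (h₁ : Y ⟶ K) (h₂ : K ⟶ Z), S.IsConflation f h₁ ∧ S.IsInflation h₂ ∧
    S.IsCompatible h₂ ∧ h₁ ≫ h₂ = g

/-- The four-term `𝔼`-triangle sequence `X ⟶ Y ⟶ Z ⟶ W` is right exact. -/
def IsRightExactSeq₄ {X Y Z W : C} (f : X ⟶ Y) (g : Y ⟶ Z) (h : Z ⟶ W) : Prop :=
  ∃ (K : C) (g₁ : Y ⟶ K) (g₂ : K ⟶ Z), S.IsConflation f g₁ ∧ S.IsConflation g₂ h ∧
    g₁ ≫ g₂ = g ∧ S.IsCompatible g₁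

/-- The four-term `𝔼`-triangle sequence `X ⟶ Y ⟶ Z ⟶ W` is left exact. -/
def IsLeftExactSeq₄ {X Y Z W : C} (f : X ⟶ Y) (g : Y ⟶ Z) (h : Z ⟶ W) : Prop :=
  ∃ (K : C) (g₁ : Y ⟶ K) (g₂ : K ⟶ Z), S.IsConflation f g₁ ∧ S.IsConflation g₂ h ∧
    g₁ ≫ g₂ = g ∧ S.IsCompatible g₂

/-- An `𝔼`-triangle sequence `0 ⟶ Xₙ ⟶ ⋯ ⟶ X₁ ⟶ X₀ ⟶ M ⟶ 0` with all `Xᵢ` in `P`: it is spliced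
from conflations `Kᵢ₊₁ ⟶ Xᵢ ⟶ Kᵢ` for `0 ≤ i ≤ n`, where `K₀ ≅ M` and `Kₙ₊₁ = 0` (so that
`Xₙ ≅ Kₙ`); its differentials are the composites `Xᵢ₊₁ ⟶ Kᵢ₊₁ ⟶ Xᵢ`. The values of the families
at indices beyond those named here are irrelevant. -/
structure Resolution (P : ObjectProperty C) (n : ℕ) (M : C) where
  X : ℕ → C
  K : ℕ → C
  g : ∀ i, K (i + 1) ⟶ X i
  f : ∀ i, X i ⟶ K i
  conflation : ∀ i, i ≤ n → S.IsConflation (g i) (f i)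
  mem : ∀ i, i ≤ n → P (X i)
  augmentation : K 0 ≅ M
  isZero : IsZero (K (n + 1))

/-- The `P`-resolution dimension of the object `M` (`⊤` if there is no finite resolution). -/
noncomputable def resDim (P : ObjectProperty C) (M : C) : ℕ∞ :=
  ⨅ (n : ℕ) (_ : Nonempty (S.Resolution P n M)), (n : ℕ∞)

/-- The `P`-resolution dimension of the category. -/
noncomputable def resDimCat (P : ObjectProperty C) : ℕ∞ :=
  ⨆ M : C, S.resDim P M

/-- The global dimension. -/
noncomputable def globalDim : ℕ∞ :=
  S.resDimCat S.projectives

end Basic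

end ExtriStructure

section Functors

variable {C : Type u₁} [Category.{v₁} C] [Preadditive C] [HasZeroObject C] [HasBinaryBiproducts C]
variable {D : Type u₂} [Category.{v₂} D] [Preadditive D] [HasZeroObject D] [HasBinaryBiproducts D]

/-- Right exact functors between extriangulated categories. -/
structure IsRightExactFunctor (S : ExtriStructure.{w₁} C) (T : ExtriStructure.{w₂} D)
    (F : C ⥤ D) : Prop where
  additive : F.Additive
  map_compatible : ∀ {X Y : C} (f : X ⟶ Y), S.IsCompatible f → T.IsCompatible (F.map f)
  map_rightExactSeq : ∀ {X Y Z : C} (f : X ⟶ Y) (g : Y ⟶ Z),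
    S.IsRightExactSeq f g → T.IsRightExactSeq (F.map f) (F.map g)

/-- Left exact functors between extriangulated categories. -/
structure IsLeftExactFunctor (S : ExtriStructure.{w₁} C) (T : ExtriStructure.{w₂} D)
    (F : C ⥤ D) : Prop where
  additive : F.Additive
  map_compatible : ∀ {X Y : C} (f : X ⟶ Y), S.IsCompatible f → T.IsCompatible (F.map f)
  map_leftExactSeq : ∀ {X Y Z : C} (f : X ⟶ Y) (g : Y ⟶ Z),
    S.IsLeftExactSeq f g → T.IsLeftExactSeq (F.map f) (F.map g)

/-- Exact functors between extriangulated categories: additive functors that preserve compatible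
morphisms and admit a natural transformation `η : 𝔼(-, -) ⟶ 𝔼'(F -, F -)` of bifunctors with
values in abelian groups such that `(F x, F y)` realizes `η δ` whenever `(x, y)` realizes `δ`. -/
structure IsExactFunctor (S : ExtriStructure.{w₁} C) (T : ExtriStructure.{w₂} D)
    (F : C ⥤ D) : Prop where
  additive : F.Additive
  map_compatible : ∀ {X Y : C} (f : X ⟶ Y), S.IsCompatible f → T.IsCompatible (F.map f)
  exists_nat : ∃ η : ∀ Z X : C, Ext S.E Z X →+ Ext T.E (F.obj Z) (F.obj X),
    (∀ {Z X X' : C} (a : X ⟶ X') (δ : Ext S.E Z X),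
      η Z X' (push S.E a δ) = push T.E (F.map a) (η Z X δ)) ∧
    (∀ {Z Z' X : C} (c : Z ⟶ Z') (δ : Ext S.E Z' X),
      η Z X (pull S.E c δ) = pull T.E (F.map c) (η Z' X δ)) ∧
    (∀ {X Y Z : C} (δ : Ext S.E Z X) (x : X ⟶ Y) (y : Y ⟶ Z),
      S.Real δ x y → T.Real (η Z X δ) (F.map x) (F.map y))

end Functors

/-- A recollement of the extriangulated category `B` relative to `A` and `C`. The functors `i_*`,
`i^*`, `i^!`, `j^*`, `j_!`, `j_*` are called `iLow`, `iStar`, `iShriek`, `jStar`, `jShriek`,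
`jLow`. -/
structure Recollement
    {A : Type u₁} [Category.{v₁} A] [Preadditive A] [HasZeroObject A] [HasBinaryBiproducts A]
    {B : Type u₂} [Category.{v₂} B] [Preadditive B] [HasZeroObject B] [HasBinaryBiproducts B]
    {C : Type u₃} [Category.{v₃} C] [Preadditive C] [HasZeroObject C] [HasBinaryBiproducts C]
    (SA : ExtriStructure.{w₁} A) (SB : ExtriStructure.{w₂} B) (SC : ExtriStructure.{w₃} C) where
  iLow : A ⥤ B
  iStar : B ⥤ A
  iShriek : B ⥤ A
  jStar : B ⥤ C
  jShriek : C ⥤ B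
  jLow : C ⥤ B
  iLow_exact : IsExactFunctor SA SB iLow
  jStar_exact : IsExactFunctor SB SC jStar
  iStar_rightExact : IsRightExactFunctor SB SA iStar
  jShriek_rightExact : IsRightExactFunctor SC SB jShriek
  iShriek_leftExact : IsLeftExactFunctor SB SA iShriek
  jLow_leftExact : IsLeftExactFunctor SC SB jLow
  /-- (R1) -/
  adjStar : iStar ⊣ iLow
  adjShriek : iLow ⊣ iShriek
  adjJShriek : jShriek ⊣ jStar
  adjJLow : jStar ⊣ jLow
  /-- (R2) -/
  im_eq_ker : ∀ Y : B, iLow.essImage Y ↔ IsZero (jStar.obj Y)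
  /-- (R3) -/
  iLow_full : iLow.Full
  iLow_faithful : iLow.Faithful
  jShriek_full : jShriek.Full
  jShriek_faithful : jShriek.Faithful
  jLow_full : jLow.Full
  jLow_faithful : jLow.Faithful
  /-- (R4) -/
  left_seq : ∀ Y : B, ∃ (X : A) (h : jLow.obj (jStar.obj Y) ⟶ iLow.obj X),
    SB.IsLeftExactSeq₄ (adjShriek.counit.app Y) (adjJLow.unit.app Y) h
  /-- (R5) -/
  right_seq : ∀ Y : B, ∃ (X : A) (h : iLow.obj X ⟶ jShriek.obj (jStar.obj Y)),
    SB.IsRightExactSeq₄ h (adjJShriek.counit.app Y) (adjStar.unit.app Y)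

end Extri

/-! Projective dimension at most `n` is recast as vanishing of `𝔼(M, -)` on all `n`-fold cosyzygies
(`HasProjDimLE`). Dimension shifting (`hasProjDimLE_succ_iff`) matches this with finite projective
resolutions, and half-exactness of `𝔼(-, V)` makes it stable under extensions, so neither higher
extension groups nor comparisons of resolutions are needed.

Exactness of `i^*` turns (R5) into a conflation `j_! j^* Y ⟶ Y ⟶ i_* i^* Y`. The functors `j_!` and
`i_*` preserve conflations, and also projectives because their right adjoints `j^*` and `i^!`
preserve conflations; this bounds `gl B` above. Conversely `M ≅ i^* i_* M` and `M ≅ j^* j_! M`, and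
`i^*`, `j^*` preserve conflations and, by way of `i_*`, `j_*`, projectives. The essential point is
that `j_!` and `j_*` preserve conflations, which is where (WIC) and the exactness of `i^*` and `i^!`
enter. -/

namespace Extri

open scoped ZeroObject

namespace ExtriStructure

/-! ### Calculus of extension groups and trivial conflations. -/

section Extensions

variable {C : Type u} [Category.{v} C] [Preadditive C] [HasZeroObject C] [HasBinaryBiproducts C]
variable (S : ExtriStructure.{w} C)

lemma push_id {Z X : C} (δ : Ext S.E Z X) : push S.E (𝟙 X) δ = δ := by simp [push]

lemma pull_id {Z X : C} (δ : Ext S.E Z X) : pull S.E (𝟙 Z) δ = δ := by simp [pull]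

lemma push_comp {Z X X' X'' : C} (a : X ⟶ X') (b : X' ⟶ X'') (δ : Ext S.E Z X) :
    push S.E (a ≫ b) δ = push S.E b (push S.E a δ) := by simp [push]

lemma pull_comp {Z Z' Z'' X : C} (a : Z ⟶ Z') (b : Z' ⟶ Z'') (δ : Ext S.E Z'' X) :
    pull S.E (a ≫ b) δ = pull S.E a (pull S.E b δ) := by simp [pull]

lemma push_pull {Z Z' X X' : C} (a : X ⟶ X') (c : Z ⟶ Z') (δ : Ext S.E Z' X) :
    push S.E a (pull S.E c δ) = pull S.E c (push S.E a δ) := by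
  exact (congrArg (fun t => t.hom δ) ((S.E.map c.op).naturality a)).symm

lemma push_ext_zero {Z X X' : C} (a : X ⟶ X') : push S.E a (0 : Ext S.E Z X) = 0 := map_zero _

lemma pull_ext_zero {Z Z' X : C} (c : Z ⟶ Z') : pull S.E c (0 : Ext S.E Z' X) = 0 := map_zero _

lemma zero_push {Z X X' : C} (δ : Ext S.E Z X) : push S.E (0 : X ⟶ X') δ = 0 := by
  have := S.additive_right (op Z)
  simp [push]

lemma zero_pull {Z Z' X : C} (δ : Ext S.E Z' X) : pull S.E (0 : Z ⟶ Z') δ = 0 := by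
  have := S.additive_left
  simp [pull]

lemma ext_eq_zero_of_isZero_left {Z X : C} (h : IsZero Z) (δ : Ext S.E Z X) : δ = 0 := by
  rw [← S.pull_id δ, h.eq_of_src (𝟙 Z) 0, S.zero_pull]

lemma ext_eq_zero_of_isZero_right {Z X : C} (h : IsZero X) (δ : Ext S.E Z X) : δ = 0 := by
  rw [← S.push_id δ, h.eq_of_src (𝟙 X) 0, S.zero_push]

lemma push_eq_zero_iff_of_isIso {Z X X' : C} (a : X ⟶ X') [IsIso a] (δ : Ext S.E Z X) :
    push S.E a δ = 0 ↔ δ = 0 := by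
  refine ⟨fun h => ?_, fun h => by rw [h, push_ext_zero]⟩
  rw [← S.push_id δ, ← IsIso.hom_inv_id a, push_comp, h, push_ext_zero]

lemma pull_eq_zero_iff_of_isIso {Z Z' X : C} (c : Z ⟶ Z') [IsIso c] (δ : Ext S.E Z' X) :
    pull S.E c δ = 0 ↔ δ = 0 := by
  refine ⟨fun h => ?_, fun h => by rw [h, pull_ext_zero]⟩
  rw [← S.pull_id δ, ← IsIso.inv_hom_id c, pull_comp, h, pull_ext_zero]

/-- The trivial sequence `X ⟶ X' ⟶ 0` given by an isomorphism. -/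
lemma real_of_isIso_left {X X' Z : C} (f : X ⟶ X') [IsIso f] (hZ : IsZero Z) :
    S.Real (0 : Ext S.E Z X) f (0 : X' ⟶ Z) := by
  rw [S.real_iff f 0 (S.real_zero X Z)]
  refine ⟨⟨biprod.fst ≫ f, inv f ≫ biprod.inl, ?_, by simp⟩, by simp, hZ.eq_of_tgt _ _⟩
  ext
  · simp
  · simp
  · exact hZ.eq_of_src _ _
  · exact hZ.eq_of_src _ _

/-- The trivial sequence `0 ⟶ Z' ⟶ Z` given by an isomorphism. -/
lemma real_of_isIso_right {X Z Z' : C} (f : Z' ⟶ Z) [IsIso f] (hX : IsZero X) :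
    S.Real (0 : Ext S.E Z X) (0 : X ⟶ Z') f := by
  rw [S.real_iff 0 f (S.real_zero X Z)]
  refine ⟨⟨biprod.snd ≫ inv f, f ≫ biprod.inr, ?_, by simp⟩, by simp, by simp⟩
  ext
  · exact hX.eq_of_src _ _
  · exact hX.eq_of_src _ _
  · simp
  · simp

end Extensions

/-! ### Weak exactness and closure properties of conflations. -/

section Sequences

variable {C : Type u} [Category.{v} C] [Preadditive C] [HasZeroObject C] [HasBinaryBiproducts C]
variable {S : ExtriStructure.{w} C}

lemma Real.comp_eq_zero {X Y Z : C} {δ : Ext S.E Z X} {x : X ⟶ Y} {y : Y ⟶ Z}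
    (h : S.Real δ x y) : x ≫ y = 0 := by
  obtain ⟨c, hc, -⟩ := S.et3 (S.real_of_isIso_left (𝟙 X) (isZero_zero C)) h (𝟙 X) x rfl
  rw [← hc, zero_comp]

lemma Real.push_eq_zero {X Y Z : C} {δ : Ext S.E Z X} {x : X ⟶ Y} {y : Y ⟶ Z}
    (h : S.Real δ x y) : push S.E x δ = 0 := by
  -- The graph of `y` maps the sequence to the split one, whose extension is zero.
  obtain ⟨a, ha, h'⟩ := S.et3_op h (S.real_zero Y Z) (biprod.lift (𝟙 Y) y) (𝟙 Z) (by simp)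
  have hx : x = a := by simpa using congrArg (fun t => t ≫ biprod.fst) ha
  rw [hx, h', pull_ext_zero]

lemma Real.pull_eq_zero {X Y Z : C} {δ : Ext S.E Z X} {x : X ⟶ Y} {y : Y ⟶ Z}
    (h : S.Real δ x y) : pull S.E y δ = 0 := by
  obtain ⟨c, hc, h'⟩ := S.et3 (S.real_zero X Y) h (𝟙 X) (biprod.desc x (𝟙 Y)) (by simp)
  have hy : c = y := by simpa using congrArg (fun t => biprod.inr ≫ t) hc
  rw [← hy, ← h', push_ext_zero]

/-- The first map of a conflation is a weak kernel of the second one. -/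
lemma Real.exists_lift {W X Y Z : C} {δ : Ext S.E Z X} {x : X ⟶ Y} {y : Y ⟶ Z}
    (h : S.Real δ x y) (f : W ⟶ Y) (hf : f ≫ y = 0) : ∃ a : W ⟶ X, a ≫ x = f := by
  obtain ⟨a, ha, -⟩ := S.et3_op (S.real_of_isIso_left (𝟙 W) (isZero_zero C)) h f 0 (by simp [hf])
  exact ⟨a, by simpa using ha.symm⟩

lemma Real.exists_lift_of_pull_eq_zero {W X Y Z : C} {δ : Ext S.E Z X} {x : X ⟶ Y} {y : Y ⟶ Z}
    (h : S.Real δ x y) (c : W ⟶ Z) (hc : pull S.E c δ = 0) : ∃ b : W ⟶ Y, b ≫ y = c := by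
  obtain ⟨b, -, hb⟩ := S.real_map (S.real_zero X W) h (𝟙 X) c (by rw [hc, push_ext_zero])
  exact ⟨biprod.inr ≫ b, by simp [← hb]⟩

lemma Real.exists_desc_of_push_eq_zero {W X Y Z : C} {δ : Ext S.E Z X} {x : X ⟶ Y} {y : Y ⟶ Z}
    (h : S.Real δ x y) (a : X ⟶ W) (ha : push S.E a δ = 0) : ∃ b : Y ⟶ W, x ≫ b = a := by
  obtain ⟨b, hb, -⟩ := S.real_map h (S.real_zero W Z) a (𝟙 Z) (by rw [ha, pull_ext_zero])
  exact ⟨b ≫ biprod.fst, by simp [reassoc_of% hb]⟩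

lemma Real.exists_pull_eq {W X Y Z : C} {δ : Ext S.E Z X} {x : X ⟶ Y} {y : Y ⟶ Z}
    (h : S.Real δ x y) (ε : Ext S.E W X) (hε : push S.E x ε = 0) :
    ∃ c : W ⟶ Z, pull S.E c δ = ε := by
  obtain ⟨T, s, t, hT⟩ := S.real_exists ε
  obtain ⟨b, hb⟩ := hT.exists_desc_of_push_eq_zero x hε
  obtain ⟨c, -, hc⟩ := S.et3 hT h (𝟙 X) b (by simp [hb])
  exact ⟨c, by rw [← hc, push_id]⟩

lemma Real.exists_push_eq {W X Y Z : C} {δ : Ext S.E Z X} {x : X ⟶ Y} {y : Y ⟶ Z}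
    (h : S.Real δ x y) (ε : Ext S.E Z W) (hε : pull S.E y ε = 0) :
    ∃ a : X ⟶ W, push S.E a δ = ε := by
  obtain ⟨T, s, t, hT⟩ := S.real_exists ε
  obtain ⟨b, hb⟩ := hT.exists_lift_of_pull_eq_zero y hε
  obtain ⟨a, -, ha⟩ := S.et3_op h hT b (𝟙 Z) (by simp [hb])
  exact ⟨a, by rw [ha, pull_id]⟩

/-- Exactness of `𝔼(-, V)` in the middle. -/
lemma Real.exists_pull_eq_of_pull_eq_zero {V X Y Z : C} {δ : Ext S.E Z X} {x : X ⟶ Y} {y : Y ⟶ Z}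
    (h : S.Real δ x y) (ε : Ext S.E Y V) (hε : pull S.E x ε = 0) :
    ∃ ε' : Ext S.E Z V, pull S.E y ε' = ε := by
  obtain ⟨T, s, t, hT⟩ := S.real_exists ε
  -- The first term `E₀` over the composite `T ⟶ Y ⟶ Z` is an extension of `X` by `V` with class
  -- `pull x ε = 0`. A retraction `r` of `d` then pushes `δ''` to the required preimage of `ε`.
  obtain ⟨E₀, d, e, h', δ'', -, -, -, hde, -, hpush⟩ := S.et4_op hT h
  obtain ⟨r, hr⟩ := hde.exists_desc_of_push_eq_zero (𝟙 V) (by rw [hε, push_ext_zero])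
  exact ⟨push S.E r δ'', by rw [← push_pull, ← hpush, ← push_comp, hr, push_id]⟩

/-- The difference `b - 𝟙` factors through `x` and is killed by precomposition with `x`, so it
squares to zero and `2 - b` inverts `b`. -/
lemma Real.isIso_of_endo {X Y Z : C} {δ : Ext S.E Z X} {x : X ⟶ Y} {y : Y ⟶ Z}
    (h : S.Real δ x y) (b : Y ⟶ Y) (hx : x ≫ b = x) (hy : b ≫ y = y) : IsIso b := by
  obtain ⟨k, hk⟩ := h.exists_lift (b - 𝟙 Y) (by simp [hy])
  have hn : (b - 𝟙 Y) ≫ (b - 𝟙 Y) = 0 := by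
    nth_rewrite 1 [← hk]
    simp [hx]
  have hbb : b ≫ b - b - b + 𝟙 Y = 0 := by
    rw [← hn]
    simp only [Preadditive.sub_comp, Preadditive.comp_sub, Category.comp_id, Category.id_comp]
    abel
  have h2 : b ≫ b = b + b - 𝟙 Y := by
    rw [← sub_eq_zero, ← hbb]
    abel
  refine ⟨𝟙 Y + 𝟙 Y - b, ?_, ?_⟩ <;>
  · simp only [Preadditive.sub_comp, Preadditive.comp_sub, Preadditive.add_comp,
      Preadditive.comp_add, Category.comp_id, Category.id_comp, h2]
    abel

lemma Real.of_iso {X Y Z X' Z' : C} {δ : Ext S.E Z X} {x : X ⟶ Y} {y : Y ⟶ Z}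
    (h : S.Real δ x y) (a : X ≅ X') (c : Z ≅ Z') :
    S.Real (push S.E a.hom (pull S.E c.inv δ)) (a.inv ≫ x) (y ≫ c.hom) := by
  -- Realize the transported extension arbitrarily and compare in both directions; the composites on
  -- the middle terms are isomorphisms by `isIso_of_endo`, hence so is `b`.
  obtain ⟨T, x', y', h'⟩ := S.real_exists (push S.E a.hom (pull S.E c.inv δ))
  obtain ⟨b, hb₁, hb₂⟩ := S.real_map h h' a.hom c.hom (by
    rw [← push_pull, ← pull_comp, c.hom_inv_id, pull_id])
  obtain ⟨b', hb₁', hb₂'⟩ := S.real_map h' h a.inv c.inv (by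
    rw [← push_comp, a.hom_inv_id, push_id])
  have i₁ : IsIso (b ≫ b') := h.isIso_of_endo _
    (by rw [reassoc_of% hb₁, hb₁', a.hom_inv_id_assoc])
    (by rw [Category.assoc, ← hb₂', ← reassoc_of% hb₂, c.hom_inv_id, Category.comp_id])
  have i₂ : IsIso (b' ≫ b) := h'.isIso_of_endo _
    (by rw [reassoc_of% hb₁', hb₁, a.inv_hom_id_assoc])
    (by rw [Category.assoc, ← hb₂, ← reassoc_of% hb₂', c.inv_hom_id, Category.comp_id])
  have hm : Mono b := mono_of_mono b b'
  have hs : IsSplitEpi b := ⟨⟨⟨inv (b' ≫ b) ≫ b', by simp⟩⟩⟩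
  have : IsIso b := isIso_of_mono_of_isSplitEpi b
  rw [S.real_iff _ _ h']
  refine ⟨(asIso b).symm, ?_, ?_⟩
  · simp [IsIso.comp_inv_eq, hb₁]
  · simp [hb₂]

lemma IsConflation.of_iso {X Y Z X' Y' Z' : C} {x : X ⟶ Y} {y : Y ⟶ Z} (h : S.IsConflation x y)
    (a : X ≅ X') (b : Y ≅ Y') (c : Z ≅ Z') (x' : X' ⟶ Y') (y' : Y' ⟶ Z')
    (hx : x ≫ b.hom = a.hom ≫ x') (hy : y ≫ c.hom = b.hom ≫ y') : S.IsConflation x' y' := by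
  obtain ⟨δ, hδ⟩ := h
  refine ⟨_, (S.real_iff _ _ (hδ.of_iso a c)).2 ⟨b, ?_, hy.symm⟩⟩
  rw [Category.assoc, hx, a.inv_hom_id_assoc]

lemma isInflation_of_isIso {X Y : C} (f : X ⟶ Y) [IsIso f] : S.IsInflation f :=
  ⟨0, 0, 0, S.real_of_isIso_left f (isZero_zero C)⟩

lemma isDeflation_of_isIso {X Y : C} (f : X ⟶ Y) [IsIso f] : S.IsDeflation f :=
  ⟨0, 0, 0, S.real_of_isIso_right f (isZero_zero C)⟩

lemma IsInflation.comp {X Y Z : C} {f : X ⟶ Y} {g : Y ⟶ Z} (hf : S.IsInflation f)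
    (hg : S.IsInflation g) : S.IsInflation (f ≫ g) := by
  obtain ⟨D, f', δ, h⟩ := hf
  obtain ⟨F, g', δ', h'⟩ := hg
  obtain ⟨E₀, k, -, -, δ'', -, -, hk, -⟩ := S.et4 h h'
  exact ⟨E₀, k, δ'', hk⟩

lemma IsDeflation.comp {X Y Z : C} {f : X ⟶ Y} {g : Y ⟶ Z} (hf : S.IsDeflation f)
    (hg : S.IsDeflation g) : S.IsDeflation (f ≫ g) := by
  obtain ⟨D, f', δ, h⟩ := hf
  obtain ⟨F, g', δ', h'⟩ := hg
  obtain ⟨E₀, -, -, k, δ'', -, -, hk, -⟩ := S.et4_op h h'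
  exact ⟨E₀, k, δ'', hk⟩

lemma isCompatible_of_isIso {X Y : C} (f : X ⟶ Y) [IsIso f] : S.IsCompatible f :=
  fun _ _ => inferInstance

lemma IsConflation.isRightExactSeq {X Y Z : C} {x : X ⟶ Y} {y : Y ⟶ Z}
    (h : S.IsConflation x y) : S.IsRightExactSeq x y :=
  ⟨X, 𝟙 X, x, h, isDeflation_of_isIso _, isCompatible_of_isIso _, Category.id_comp _⟩

lemma IsConflation.isLeftExactSeq {X Y Z : C} {x : X ⟶ Y} {y : Y ⟶ Z}
    (h : S.IsConflation x y) : S.IsLeftExactSeq x y :=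
  ⟨Z, y, 𝟙 Z, h, isInflation_of_isIso _, isCompatible_of_isIso _, Category.comp_id _⟩

/-- Invertibility of `x` forces both `y` and the extension to vanish, so `𝟙 Z` lifts through `y =
0`. -/
lemma IsConflation.isZero_right {X Y Z : C} {x : X ⟶ Y} {y : Y ⟶ Z}
    (h : S.IsConflation x y) [IsIso x] : IsZero Z := by
  obtain ⟨δ, hδ⟩ := h
  have hy : y = 0 := by
    rw [← cancel_epi x, hδ.comp_eq_zero, comp_zero]
  have h0 := (S.push_eq_zero_iff_of_isIso x δ).1 hδ.push_eq_zero
  obtain ⟨b, hb⟩ := hδ.exists_lift_of_pull_eq_zero (𝟙 Z) (by rw [h0, pull_ext_zero])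
  rw [IsZero.iff_id_eq_zero, ← hb, hy, comp_zero]

lemma IsConflation.isZero_left {X Y Z : C} {x : X ⟶ Y} {y : Y ⟶ Z}
    (h : S.IsConflation x y) [IsIso y] : IsZero X := by
  obtain ⟨δ, hδ⟩ := h
  have hx : x = 0 := by
    rw [← cancel_mono y, hδ.comp_eq_zero, zero_comp]
  have h0 := (S.pull_eq_zero_iff_of_isIso y δ).1 hδ.pull_eq_zero
  obtain ⟨b, hb⟩ := hδ.exists_desc_of_push_eq_zero (𝟙 X) (by rw [h0, push_ext_zero])
  rw [IsZero.iff_id_eq_zero, ← hb, hx, zero_comp]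

lemma IsConflation.isIso_left {X Y Z : C} {x : X ⟶ Y} {y : Y ⟶ Z}
    (h : S.IsConflation x y) (hZ : IsZero Z) : IsIso x := by
  obtain ⟨δ, hδ⟩ := h
  obtain rfl := S.ext_eq_zero_of_isZero_left hZ δ
  obtain ⟨b, hb, -⟩ := (S.real_iff x y (S.real_of_isIso_left (𝟙 X) hZ)).1 hδ
  rw [← hb]
  infer_instance

lemma IsConflation.isIso_right {X Y Z : C} {x : X ⟶ Y} {y : Y ⟶ Z}
    (h : S.IsConflation x y) (hX : IsZero X) : IsIso y := by
  obtain ⟨δ, hδ⟩ := h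
  obtain rfl := S.ext_eq_zero_of_isZero_right hX δ
  obtain ⟨b, -, hb⟩ := (S.real_iff x y (S.real_of_isIso_right (𝟙 Z) hX)).1 hδ
  rw [Iso.eq_inv_comp b |>.2 hb]
  infer_instance

end Sequences

/-! ### Projective dimension through cosyzygies. -/

section ProjectiveDimension

variable {C : Type u} [Category.{v} C] [Preadditive C] [HasZeroObject C] [HasBinaryBiproducts C]
variable {S : ExtriStructure.{w} C}

/-- Lifting `𝟙 P` splits every extension of `P`; conversely `pull c δ` is the obstruction to lifting
`c`. -/
lemma projectives_iff (P : C) :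
    S.projectives P ↔ ∀ (X : C) (ε : Ext S.E P X), ε = 0 := by
  constructor
  · intro hP X ε
    obtain ⟨T, x, y, h⟩ := S.real_exists ε
    obtain ⟨s, hs⟩ := hP x y ⟨ε, h⟩ (𝟙 P)
    rw [← S.pull_id ε, ← hs, pull_comp, h.pull_eq_zero, pull_ext_zero]
  · rintro hP X Y Z x y ⟨δ, h⟩ c
    exact h.exists_lift_of_pull_eq_zero c (hP _ _)

lemma ext_eq_zero_of_injectives {I : C} (hI : S.injectives I) {Z : C} (ε : Ext S.E Z I) :
    ε = 0 := by
  obtain ⟨T, x, y, h⟩ := S.real_exists ε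
  obtain ⟨s, hs⟩ := hI x y ⟨ε, h⟩ (𝟙 I)
  rw [← S.push_id ε, ← hs, push_comp, h.push_eq_zero, push_ext_zero]

variable (S) in
/-- `V` is an `n`-fold cosyzygy of some object. -/
def IsCosyzygy : ℕ → C → Prop
  | 0, _ => True
  | n + 1, V' => ∃ (V I : C) (i : V ⟶ I) (l : I ⟶ V'),
      S.IsConflation i l ∧ S.injectives I ∧ IsCosyzygy n V

lemma IsCosyzygy.of_succ : ∀ {n : ℕ} {V : C}, S.IsCosyzygy (n + 1) V → S.IsCosyzygy n V
  | 0, _, _ => trivial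
  | _ + 1, _, ⟨V, I, i, l, h, hI, hV⟩ => ⟨V, I, i, l, h, hI, hV.of_succ⟩

variable (S) in
/-- `M` has projective dimension at most `n`, in terms of the vanishing of `𝔼(M, -)` on
`n`-fold cosyzygies. -/
def HasProjDimLE (n : ℕ) (M : C) : Prop :=
  ∀ V : C, S.IsCosyzygy n V → ∀ ε : Ext S.E M V, ε = 0

lemma hasProjDimLE_zero_iff (M : C) : S.HasProjDimLE 0 M ↔ S.projectives M := by
  rw [projectives_iff]
  exact ⟨fun h V => h V trivial, fun h V _ => h V⟩

lemma HasProjDimLE.succ {n : ℕ} {M : C} (h : S.HasProjDimLE n M) : S.HasProjDimLE (n + 1) M :=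
  fun V hV => h V hV.of_succ

lemma HasProjDimLE.mono {m n : ℕ} (hmn : m ≤ n) {M : C} (h : S.HasProjDimLE m M) :
    S.HasProjDimLE n M := by
  induction hmn with
  | refl => exact h
  | step _ ih => exact ih.succ

lemma HasProjDimLE.of_iso {n : ℕ} {M M' : C} (h : S.HasProjDimLE n M) (e : M ≅ M') :
    S.HasProjDimLE n M' :=
  fun V hV ε => (S.pull_eq_zero_iff_of_isIso e.hom ε).1 (h V hV _)

lemma HasProjDimLE.of_conflation {n : ℕ} {X Y Z : C} {x : X ⟶ Y} {y : Y ⟶ Z}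
    (h : S.IsConflation x y) (hX : S.HasProjDimLE n X) (hZ : S.HasProjDimLE n Z) :
    S.HasProjDimLE n Y := by
  intro V hV ε
  obtain ⟨δ, hδ⟩ := h
  obtain ⟨ε', rfl⟩ := hδ.exists_pull_eq_of_pull_eq_zero ε (hX V hV _)
  rw [hZ V hV ε', pull_ext_zero]

/-- Dimension shifting: for a conflation `V ⟶ I ⟶ V'` with `I` injective, vanishing of `𝔼(M, V')`
and of `𝔼(K, V)` both express that each map `K ⟶ V'`, respectively `K ⟶ V`-extension class, is
trivial modulo maps through `P` or `I`. -/
lemma hasProjDimLE_succ_iff (inj : S.HasEnoughInjectives) {n : ℕ} {K P M : C} {k : K ⟶ P}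
    {p : P ⟶ M} (h : S.IsConflation k p) (hP : S.projectives P) :
    S.HasProjDimLE (n + 1) M ↔ S.HasProjDimLE n K := by
  obtain ⟨δ, hδ⟩ := h
  constructor
  · intro hM V hV ε
    obtain ⟨I, V', i, l, hI, θ, hθ⟩ := inj V
    -- The class is pulled back from `θ` along some `c : K ⟶ V'`; `c` extends to `P` and then lifts
    -- to `I`, where `θ` dies.
    obtain ⟨c, rfl⟩ := hθ.exists_pull_eq ε (ext_eq_zero_of_injectives hI _)
    obtain ⟨b, rfl⟩ := hδ.exists_desc_of_push_eq_zero c (hM V' ⟨V, I, i, l, ⟨θ, hθ⟩, hI, hV⟩ _)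
    obtain ⟨b', rfl⟩ := hP i l ⟨θ, hθ⟩ b
    rw [pull_comp, pull_comp, hθ.pull_eq_zero, pull_ext_zero, pull_ext_zero]
  · rintro hK V' ⟨V, I, i, l, ⟨θ, hθ⟩, hI, hV⟩ ε
    obtain ⟨a, rfl⟩ := hδ.exists_push_eq ε ((projectives_iff P).1 hP _ _)
    obtain ⟨b, rfl⟩ := hθ.exists_lift_of_pull_eq_zero a (hK V hV _)
    obtain ⟨b', rfl⟩ := hI k p ⟨δ, hδ⟩ b
    rw [push_comp, push_comp, hδ.push_eq_zero, push_ext_zero, push_ext_zero]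

/-- The resolution of the first syzygy cut out of a resolution. -/
def Resolution.tail {P : ObjectProperty C} {n : ℕ} {M : C} (r : S.Resolution P (n + 1) M) :
    S.Resolution P n (r.K 1) where
  X i := r.X (i + 1)
  K i := r.K (i + 1)
  g i := r.g (i + 1)
  f i := r.f (i + 1)
  conflation i hi := r.conflation (i + 1) (by omega)
  mem i hi := r.mem (i + 1) (by omega)
  augmentation := Iso.refl _
  isZero := r.isZero

lemma Resolution.hasProjDimLE (inj : S.HasEnoughInjectives) {n : ℕ} {M : C}
    (r : S.Resolution S.projectives n M) : S.HasProjDimLE n M := by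
  induction n generalizing M with
  | zero =>
    have := (r.conflation 0 le_rfl).isIso_right r.isZero
    exact ((hasProjDimLE_zero_iff _).2 (r.mem 0 le_rfl)).of_iso
      (asIso (r.f 0) ≪≫ r.augmentation)
  | succ n ih =>
    exact ((hasProjDimLE_succ_iff inj (r.conflation 0 (by omega)) (r.mem 0 (by omega))).2
      (ih r.tail)).of_iso r.augmentation

/-- The resolution of length zero of an object satisfying `P`. -/
noncomputable def Resolution.ofMem {P : ObjectProperty C} {M : C} (hM : P M) :
    S.Resolution P 0 M where
  X _ := M
  K i := Nat.casesOn i M fun _ => 0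
  g _ := 0
  f i := Nat.casesOn i (𝟙 M) fun _ => 0
  conflation i hi := by
    obtain rfl := Nat.le_zero.1 hi
    exact ⟨0, S.real_of_isIso_right (𝟙 M) (isZero_zero C)⟩
  mem _ _ := hM
  augmentation := Iso.refl _
  isZero := isZero_zero C

/-- Splice a conflation with a resolution of its first term. -/
def Resolution.cons {P : ObjectProperty C} {n : ℕ} {L Q M : C} {k : L ⟶ Q} {p : Q ⟶ M}
    (h : S.IsConflation k p) (hQ : P Q) (r : S.Resolution P n L) :
    S.Resolution P (n + 1) M where
  X i := Nat.casesOn i Q r.X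
  K i := Nat.casesOn i M r.K
  -- The next syzygy is `r.K 0`, which is only isomorphic to `L`.
  g i := Nat.casesOn i (r.augmentation.hom ≫ k) r.g
  f i := Nat.casesOn i p r.f
  conflation i hi := by
    cases i with
    | zero =>
      exact h.of_iso r.augmentation.symm (Iso.refl _) (Iso.refl _) _ _ (by simp) (by simp)
    | succ i => exact r.conflation i (by omega)
  mem i hi := by
    cases i with
    | zero => exact hQ
    | succ i => exact r.mem i (by omega)
  augmentation := Iso.refl _
  isZero := r.isZero

lemma HasProjDimLE.nonempty_resolution (proj : S.HasEnoughProjectives)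
    (inj : S.HasEnoughInjectives) {n : ℕ} {M : C} (h : S.HasProjDimLE n M) :
    Nonempty (S.Resolution S.projectives n M) := by
  induction n generalizing M with
  | zero => exact ⟨Resolution.ofMem ((hasProjDimLE_zero_iff M).1 h)⟩
  | succ n ih =>
    obtain ⟨K, P, k, p, hP, hkp⟩ := proj M
    obtain ⟨r⟩ := ih ((hasProjDimLE_succ_iff inj hkp hP).1 h)
    exact ⟨Resolution.cons hkp hP r⟩

lemma resDim_le_iff (proj : S.HasEnoughProjectives) (inj : S.HasEnoughInjectives) (n : ℕ) (M : C) :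
    S.resDim S.projectives M ≤ n ↔ S.HasProjDimLE n M := by
  constructor
  · intro h
    -- The strict bound by `n + 1` extracts an actual resolution from the infimum.
    have hlt : S.resDim S.projectives M < ((n + 1 : ℕ) : ℕ∞) :=
      h.trans_lt (by exact_mod_cast Nat.lt_succ_self n)
    simp only [resDim, iInf_lt_iff] at hlt
    obtain ⟨m, ⟨r⟩, hm⟩ := hlt
    exact (r.hasProjDimLE inj).mono (Nat.lt_succ_iff.1 (by exact_mod_cast hm))
  · intro h
    exact iInf₂_le n (h.nonempty_resolution proj inj)

lemma globalDim_le_iff (proj : S.HasEnoughProjectives) (inj : S.HasEnoughInjectives) (n : ℕ) :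
    S.globalDim ≤ n ↔ ∀ M : C, S.HasProjDimLE n M := by
  simp only [globalDim, resDimCat, iSup_le_iff, resDim_le_iff proj inj]

end ProjectiveDimension

/-! ### Transport of projectives and resolutions along functors. -/

section Functoriality

variable {C : Type u₁} [Category.{v₁} C] [Preadditive C] [HasZeroObject C] [HasBinaryBiproducts C]
variable {D : Type u₂} [Category.{v₂} D] [Preadditive D] [HasZeroObject D] [HasBinaryBiproducts D]

/-- `F` sends conflations to conflations. -/
def PreservesConflations (S : ExtriStructure.{w₁} C) (T : ExtriStructure.{w₂} D)
    (F : C ⥤ D) : Prop :=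
  ∀ ⦃X Y Z : C⦄ ⦃x : X ⟶ Y⦄ ⦃y : Y ⟶ Z⦄, S.IsConflation x y → T.IsConflation (F.map x) (F.map y)

variable {S : ExtriStructure.{w₁} C} {T : ExtriStructure.{w₂} D} {F : C ⥤ D} {G : D ⥤ C}

lemma _root_.Extri.IsExactFunctor.preservesConflations (hF : IsExactFunctor S T F) :
    PreservesConflations S T F := by
  rintro X Y Z x y ⟨δ, h⟩
  obtain ⟨η, -, -, hη⟩ := hF.exists_nat
  exact ⟨_, hη δ x y h⟩

lemma PreservesConflations.isInflation (hF : PreservesConflations S T F) {X Y : C} {x : X ⟶ Y}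
    (h : S.IsInflation x) : T.IsInflation (F.map x) := by
  obtain ⟨Z, y, h⟩ := h
  exact ⟨_, _, hF h⟩

lemma PreservesConflations.isDeflation (hF : PreservesConflations S T F) {X Y : C} {x : X ⟶ Y}
    (h : S.IsDeflation x) : T.IsDeflation (F.map x) := by
  obtain ⟨Z, y, h⟩ := h
  exact ⟨_, _, hF h⟩

/-- A left adjoint of a conflation preserving functor preserves projectives. -/
lemma PreservesConflations.projectives (hG : PreservesConflations T S G) (adj : F ⊣ G) {P : C}
    (hP : S.projectives P) : T.projectives (F.obj P) := by
  intro X Y Z x y h c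
  obtain ⟨b, hb⟩ := hP _ _ (hG h) (adj.homEquiv _ _ c)
  refine ⟨(adj.homEquiv _ _).symm b, ?_⟩
  rw [← adj.homEquiv_naturality_right_symm, hb, Equiv.symm_apply_apply]

/-- The image of a resolution under a functor preserving conflations and zero objects. -/
def Resolution.map {P : ObjectProperty C} {Q : ObjectProperty D} {n : ℕ} {M : C}
    (r : S.Resolution P n M) (hF : PreservesConflations S T F)
    (hF₀ : ∀ X : C, IsZero X → IsZero (F.obj X)) (hPQ : ∀ X : C, P X → Q (F.obj X)) :
    T.Resolution Q n (F.obj M) where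
  X i := F.obj (r.X i)
  K i := F.obj (r.K i)
  g i := F.map (r.g i)
  f i := F.map (r.f i)
  conflation i hi := hF (r.conflation i hi)
  mem i hi := hPQ _ (r.mem i hi)
  augmentation := F.mapIso r.augmentation
  isZero := hF₀ _ r.isZero

/-- The argument passes through an actual resolution, since `F` is not assumed to preserve
injectives or cosyzygies. -/
lemma HasProjDimLE.map [F.Additive] (proj : S.HasEnoughProjectives) (injS : S.HasEnoughInjectives)
    (injT : T.HasEnoughInjectives) (hF : PreservesConflations S T F)
    (hP : ∀ X : C, S.projectives X → T.projectives (F.obj X)) {n : ℕ} {M : C}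
    (h : S.HasProjDimLE n M) : T.HasProjDimLE n (F.obj M) := by
  obtain ⟨r⟩ := h.nonempty_resolution proj injS
  exact (r.map hF (fun X hX => F.map_isZero hX) hP).hasProjDimLE injT

end Functoriality

end ExtriStructure

/-! ### Conflations in a recollement. -/

namespace Recollement

open ExtriStructure

variable {A : Type u₁} [Category.{v₁} A] [Preadditive A] [HasZeroObject A] [HasBinaryBiproducts A]
  {B : Type u₂} [Category.{v₂} B] [Preadditive B] [HasZeroObject B] [HasBinaryBiproducts B]
  {C : Type u₃} [Category.{v₃} C] [Preadditive C] [HasZeroObject C] [HasBinaryBiproducts C]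
  {SA : ExtriStructure.{w₁} A} {SB : ExtriStructure.{w₂} B} {SC : ExtriStructure.{w₃} C}
  (R : Recollement SA SB SC)

attribute [local instance] iLow_full iLow_faithful jShriek_full jShriek_faithful jLow_full
  jLow_faithful

lemma isZero_jStar_iLow (X : A) : IsZero (R.jStar.obj (R.iLow.obj X)) :=
  (R.im_eq_ker _).1 (R.iLow.obj_mem_essImage X)

/-- By adjunction, maps `i^* j_! X ⟶ V` correspond to maps `X ⟶ j^* i_* V = 0`. -/
lemma isZero_iStar_jShriek (X : C) : IsZero (R.iStar.obj (R.jShriek.obj X)) := by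
  rw [IsZero.iff_id_eq_zero]
  exact (R.adjStar.homEquiv _ _).injective ((R.adjJShriek.homEquiv _ _).injective
    ((R.isZero_jStar_iLow _).eq_of_tgt _ _))

lemma isZero_iShriek_jLow (X : C) : IsZero (R.iShriek.obj (R.jLow.obj X)) := by
  rw [IsZero.iff_id_eq_zero]
  exact (R.adjShriek.homEquiv _ _).symm.injective ((R.adjJLow.homEquiv _ _).symm.injective
    ((R.isZero_jStar_iLow _).eq_of_src _ _))

/-- `j_*` preserves conflations if `i^!` is exact. -/
lemma jLow_preservesConflations (wicC : SC.WIC) (hShriek : IsExactFunctor SB SA R.iShriek) :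
    PreservesConflations SC SB R.jLow := by
  intro X Y Z x y h
  obtain ⟨K, h₁, h₂, hK, ⟨W, w, hW⟩, hcomp, hy⟩ :=
    R.jLow_leftExact.map_leftExactSeq x y h.isLeftExactSeq
  have hj := R.jStar_exact.preservesConflations
  have hi := hShriek.preservesConflations
  -- Up to the counit isomorphisms, `j^* h₁ ≫ j^* h₂` is the deflation `y`, so (WIC) makes `j^* h₂`
  -- a deflation as well as a compatible inflation.
  have hiso : IsIso (R.jStar.map h₂) := by
    refine R.jStar_exact.map_compatible h₂ hcomp (hj.isInflation ⟨W, w, hW⟩) ?_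
    have hd : SC.IsDeflation (R.adjJLow.counit.app Y ≫ y) :=
      (isDeflation_of_isIso _).comp ⟨X, x, h⟩
    have he : R.adjJLow.counit.app Y ≫ y =
        R.jStar.map h₁ ≫ R.jStar.map h₂ ≫ R.adjJLow.counit.app Z := by
      rw [← R.jStar.map_comp_assoc, hy]
      simp
    rw [he] at hd
    have hd' := (wicC.deflation_of_comp _ _ hd).comp
      (isDeflation_of_isIso (inv (R.adjJLow.counit.app Z)))
    simpa using hd'
  -- The cokernel term `W` of `h₂` is killed by `j^*`, hence is `i_* V`. Since `i^!` is exact and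
  -- kills `j_*`, it kills `K` and `W`, so `V ≅ i^! i_* V` is zero and `h₂` is invertible.
  obtain ⟨V, ⟨e⟩⟩ := (R.im_eq_ker W).2 (hj hW).isZero_right
  have hK₀ : IsZero (R.iShriek.obj K) := by
    have := (R.isZero_iShriek_jLow X).isIso (R.isZero_iShriek_jLow Y)
      (R.iShriek.map (R.jLow.map x))
    exact (hi hK).isZero_right
  have hW₀ : IsZero (R.iShriek.obj W) := by
    have := hK₀.isIso (R.isZero_iShriek_jLow Z) (R.iShriek.map h₂)
    exact (hi hW).isZero_right
  have hV : IsZero V :=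
    hW₀.of_iso (asIso (R.adjShriek.unit.app V) ≪≫ R.iShriek.mapIso e)
  have := R.iLow_exact.additive
  have := hW.isIso_left ((R.iLow.map_isZero hV).of_iso e.symm)
  exact hK.of_iso (Iso.refl _) (Iso.refl _) (asIso h₂) _ _ (by simp) (by simp [hy])

/-- `j_!` preserves conflations if `i^*` is exact. -/
lemma jShriek_preservesConflations (wicC : SC.WIC) (hStar : IsExactFunctor SB SA R.iStar) :
    PreservesConflations SC SB R.jShriek := by
  intro X Y Z x y h
  obtain ⟨K, h₁, h₂, hK, ⟨W, w, hW⟩, hcomp, hx⟩ :=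
    R.jShriek_rightExact.map_rightExactSeq x y h.isRightExactSeq
  have hj := R.jStar_exact.preservesConflations
  have hi := hStar.preservesConflations
  have hiso : IsIso (R.jStar.map h₁) := by
    refine R.jStar_exact.map_compatible h₁ hcomp ?_ (hj.isDeflation ⟨W, w, hW⟩)
    have hd : SC.IsInflation (x ≫ R.adjJShriek.unit.app Y) :=
      IsInflation.comp ⟨Z, y, h⟩ (isInflation_of_isIso _)
    have he : x ≫ R.adjJShriek.unit.app Y =
        (R.adjJShriek.unit.app X ≫ R.jStar.map h₁) ≫ R.jStar.map h₂ := by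
      rw [Category.assoc, ← R.jStar.map_comp, hx]
      exact R.adjJShriek.unit.naturality x
    rw [he] at hd
    have hd' := (isInflation_of_isIso (inv (R.adjJShriek.unit.app X))).comp
      (wicC.inflation_of_comp _ _ hd)
    simpa using hd'
  -- Dually, the kernel term `W` of `h₁` comes from `A` and is killed by `i^*`, so it vanishes.
  obtain ⟨V, ⟨e⟩⟩ := (R.im_eq_ker W).2 (hj hW).isZero_left
  have hK₀ : IsZero (R.iStar.obj K) := by
    have := (R.isZero_iStar_jShriek Y).isIso (R.isZero_iStar_jShriek Z)
      (R.iStar.map (R.jShriek.map y))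
    exact (hi hK).isZero_left
  have hW₀ : IsZero (R.iStar.obj W) := by
    have := (R.isZero_iStar_jShriek X).isIso hK₀ (R.iStar.map h₁)
    exact (hi hW).isZero_left
  have hV : IsZero V :=
    hW₀.of_iso ((asIso (R.adjStar.counit.app V)).symm ≪≫ R.iStar.mapIso e)
  have := R.iLow_exact.additive
  have := hW.isIso_right ((R.iLow.map_isZero hV).of_iso e.symm)
  exact hK.of_iso (asIso h₁).symm (Iso.refl _) (Iso.refl _) _ _ (by simp [← hx]) (by simp)

/-- If `i^*` is exact, then `j_! j^* Y ⟶ Y ⟶ i_* i^* Y` is a conflation. -/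
lemma isConflation_counit_unit (hStar : IsExactFunctor SB SA R.iStar) (Y : B) :
    SB.IsConflation (R.adjJShriek.counit.app Y) (R.adjStar.unit.app Y) := by
  obtain ⟨X, h, K, g₁, g₂, hK, hY, hg, -⟩ := R.right_seq Y
  have hi := hStar.preservesConflations
  have hK₀ : IsZero (R.iStar.obj K) := by
    -- The triangle identity and the invertible counit of `i^* ⊣ i_*` give this; then `i^*` kills
    -- `K`, hence `i_* X`, so `X` is zero and `g₁` is invertible.
    have : IsIso (R.iStar.map (R.adjStar.unit.app Y)) :=
      ⟨R.adjStar.counit.app _, by simp, by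
        rw [← cancel_mono (R.adjStar.counit.app _)]
        simp⟩
    exact (hi hY).isZero_left
  have hX₀ : IsZero (R.iStar.obj (R.iLow.obj X)) := by
    have := (R.isZero_iStar_jShriek (R.jStar.obj Y)).isIso hK₀ (R.iStar.map g₁)
    exact (hi hK).isZero_left
  have hX : IsZero X := hX₀.of_iso (asIso (R.adjStar.counit.app X)).symm
  have := R.iLow_exact.additive
  have := hK.isIso_right (R.iLow.map_isZero hX)
  exact hY.of_iso (asIso g₁).symm (Iso.refl _) (Iso.refl _) _ _ (by simp [← hg]) (by simp)

end Recollement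

end Extri

theorem mainTheorem8
    {A : Type u₁} [Category.{v₁} A] [Preadditive A] [HasZeroObject A] [HasBinaryBiproducts A]
    {B : Type u₂} [Category.{v₂} B] [Preadditive B] [HasZeroObject B] [HasBinaryBiproducts B]
    {C : Type u₃} [Category.{v₃} C] [Preadditive C] [HasZeroObject C] [HasBinaryBiproducts C]
    (SA : Extri.ExtriStructure.{w₁} A) (SB : Extri.ExtriStructure.{w₂} B)
    (SC : Extri.ExtriStructure.{w₃} C)
    (wicA : SA.WIC) (wicB : SB.WIC) (wicC : SC.WIC)
    (projA : SA.HasEnoughProjectives) (projB : SB.HasEnoughProjectives)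
    (projC : SC.HasEnoughProjectives)
    (injA : SA.HasEnoughInjectives) (injB : SB.HasEnoughInjectives)
    (injC : SC.HasEnoughInjectives)
    (R : Extri.Recollement SA SB SC)
    (hStar : Extri.IsExactFunctor SB SA R.iStar)
    (hShriek : Extri.IsExactFunctor SB SA R.iShriek) :
    SB.globalDim = max SA.globalDim SC.globalDim := by
  have := hStar.additive
  have := R.iLow_exact.additive
  have := R.jStar_exact.additive
  have := R.jShriek_rightExact.additive
  have := R.iLow_full
  have := R.iLow_faithful
  have := R.jShriek_full
  have := R.jShriek_faithful
  have hi := R.iLow_exact.preservesConflations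
  have hj := R.jStar_exact.preservesConflations
  -- It suffices to compare finite upper bounds, the bound `⊤` being automatic.
  have key (n : ℕ) : SB.globalDim ≤ n ↔ max SA.globalDim SC.globalDim ≤ n := by
    rw [max_le_iff, Extri.ExtriStructure.globalDim_le_iff projB injB,
      Extri.ExtriStructure.globalDim_le_iff projA injA,
      Extri.ExtriStructure.globalDim_le_iff projC injC]
    constructor
    · refine fun h => ⟨fun M => ?_, fun M => ?_⟩
      · exact ((h (R.iLow.obj M)).map projB injB injA hStar.preservesConflations
          (fun _ => hi.projectives R.adjStar)).of_iso (asIso (R.adjStar.counit.app M))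
      · exact ((h (R.jShriek.obj M)).map projB injB injC hj
          (fun _ => (R.jLow_preservesConflations wicC hShriek).projectives R.adjJLow)).of_iso
          (asIso (R.adjJShriek.unit.app M)).symm
    · rintro ⟨hA, hC⟩ M
      exact .of_conflation (R.isConflation_counit_unit hStar M)
        ((hC _).map projC injC injB (R.jShriek_preservesConflations wicC hStar)
          (fun _ => hj.projectives R.adjJShriek))
        ((hA _).map projA injA injB hi
          (fun _ => hShriek.preservesConflations.projectives R.adjShriek))
  refine eq_of_forall_ge_iff fun c => ?_
  cases c with
  | top => simp
  | coe n => exact key n
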